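/- Let $A,A',B$ be qubits and $$\rho_{AA'B}=\tfrac12\big(|\phi_0\rangle\langle\phi_0|+|\phi_1\rangle\langle\phi_1|\big),\quad |\phi_0\rangle=|0\rangle_{A'}\otimes\tfrac1{\sqrt2}(|00\rangle_{AB}+|11\rangle_{AB}),\quad |\phi_1\rangle=|1\rangle_{A'}\otimes\tfrac1{\sqrt2}(|01\rangle_{AB}+|10\rangle_{AB}).$$ Let $S(\sigma)=-\mathrm{Tr}\,\sigma\log_2\sigma$ be the von Neumann entropy and $I(X\rangle B)=S(\sigma_B)-S(\sigma_{XB})$ the coherent information of a state $\sigma_{XB}$. For a class $O$ of operations of the two senders $A,A'$, the quantum advantage of dense coding of a state $\sigma_{AA'B}$ from $AA'$ to $B$ is $$\Delta_O=S(\sigma_B)-\inf_{\Lambda\in O}S\big((\Lambda\otimes\mathrm{id}_B)[\sigma_{AA'B}]\big),$$ where the infimum runs over all maps $\Lambda$ in $O$ acting on $AA'$, with arbitrary finite output dimensions. LO is the class of maps $\Lambda_A\otimes\Lambda_{A'}$ with $\Lambda_A,\Lambda_{A'}$ completely positive and trace preserving. LOCC is the class of maps realized by finitely many rounds of local instruments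 of $A$ or of $A'$, each possibly depending on all previously announced outcomes. Then: 1. $\rho_{AA'B}$ is a density matrix with $S(\rho_{AA'B})=S(\rho_B)=1$ and $I(AA'\rangle B)=0$. 2. $\rho_{AA'B}$ is separable in the cut $A':AB$, and its reduction $\rho_{AB}$ is separable. 3. $\Delta_{LO}=0$ for $\rho_{AA'B}$. 4. Consider the protocol in which $A'$ measures in the basis $\{|0\rangle,|1\rangle\}$ and tells $A$ the outcome $i$, $A$ applies the identity if $i=0$ and the bit flip if $i=1$, and $A'$ is replaced by a fresh system in the state $|0\rangle$. It is an LOCC operation and transforms $\rho_{AA'B}$ into the pure state $|\phi_0\rangle\langle\phi_0|$, so that after it $S'(AA'B)=0$ and $I'(AA'\rangle B)=1$. 5. Consequently $\Delta_{LOCC}\ge 1$ for $\rho_{AA'B}$. -/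

import Mathlib

open scoped Kronecker ComplexOrder

noncomputable section

namespace DenseCoding

/-! Index types: `Matrix a a ℂ` is the algebra of operators on the Hilbert space with orthonormal
basis `a`; `Matrix (a × b) (a × b) ℂ` is the algebra of operators on the tensor product. -/

section Basic

variable {a b c d : Type*}

/-- The density operators: positive semidefinite with unit trace. -/
def IsDensity [Fintype a] (ρ : Matrix a a ℂ) : Prop :=
  ρ.PosSemidef ∧ ρ.trace = 1

open Classical in
/-- The von Neumann entropy `S(ρ) = -Tr ρ log₂ ρ = -∑ λ log₂ λ`, the sum running over the
eigenvalues of `ρ` with multiplicity, and `0 log 0 = 0`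
(the value at a non-Hermitian matrix is a dummy). -/
def entropy [Fintype a] [DecidableEq a] (ρ : Matrix a a ℂ) : ℝ :=
  if h : ρ.IsHermitian then -∑ i, h.eigenvalues i * Real.logb 2 (h.eigenvalues i) else 0

/-- The partial trace over the first factor. -/
def traceFst [Fintype a] (ρ : Matrix (a × b) (a × b) ℂ) : Matrix b b ℂ :=
  Matrix.of fun i j => ∑ p, ρ (p, i) (p, j)

/-- The coherent information `I(X⟩B) = S(ρ_B) - S(ρ_XB)` of an operator on `X ⊗ B`. -/
def coherentInfo [Fintype a] [DecidableEq a] [Fintype b] [DecidableEq b]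
    (ρ : Matrix (a × b) (a × b) ℂ) : ℝ :=
  entropy (traceFst ρ) - entropy ρ

/-- Separability of a bipartite state: a finite convex combination of product states. -/
def IsSepState [Fintype a] [Fintype b] (ρ : Matrix (a × b) (a × b) ℂ) : Prop :=
  ∃ (r : ℕ) (p : Fin r → ℝ) (σ : Fin r → Matrix a a ℂ) (τ : Fin r → Matrix b b ℂ),
    (∀ i, 0 ≤ p i) ∧ ∑ i, p i = 1 ∧ (∀ i, IsDensity (σ i)) ∧ (∀ i, IsDensity (τ i)) ∧
      ρ = ∑ i, (p i : ℂ) • (σ i ⊗ₖ τ i)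

/-- The map `Φ ⊗ id`: apply `Φ` blockwise. -/
def tensorId (Φ : Matrix a a ℂ →ₗ[ℂ] Matrix b b ℂ) :
    Matrix (a × c) (a × c) ℂ →ₗ[ℂ] Matrix (b × c) (b × c) ℂ where
  toFun X := Matrix.of fun i j => Φ (Matrix.of fun p q => X (p, i.2) (q, j.2)) i.1 j.1
  map_add' X Y := by
    ext i j
    exact congrFun (congrFun (map_add Φ (Matrix.of fun p q => X (p, i.2) (q, j.2))
      (Matrix.of fun p q => Y (p, i.2) (q, j.2))) i.1) j.1
  map_smul' z X := by
    ext i j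
    exact congrFun (congrFun (map_smul Φ z (Matrix.of fun p q => X (p, i.2) (q, j.2))) i.1) j.1

/-- The map `id ⊗ Ψ`: apply `Ψ` blockwise. -/
def idTensor (Ψ : Matrix c c ℂ →ₗ[ℂ] Matrix d d ℂ) :
    Matrix (a × c) (a × c) ℂ →ₗ[ℂ] Matrix (a × d) (a × d) ℂ where
  toFun X := Matrix.of fun i j => Ψ (Matrix.of fun p q => X (i.1, p) (j.1, q)) i.2 j.2
  map_add' X Y := by
    ext i j
    exact congrFun (congrFun (map_add Ψ (Matrix.of fun p q => X (i.1, p) (j.1, q))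
      (Matrix.of fun p q => Y (i.1, p) (j.1, q))) i.2) j.2
  map_smul' z X := by
    ext i j
    exact congrFun (congrFun (map_smul Ψ z (Matrix.of fun p q => X (i.1, p) (j.1, q))) i.2) j.2

/-- The tensor product `Φ ⊗ Ψ` of two linear maps between operator algebras. -/
def tensorMap (Φ : Matrix a a ℂ →ₗ[ℂ] Matrix b b ℂ) (Ψ : Matrix c c ℂ →ₗ[ℂ] Matrix d d ℂ) :
    Matrix (a × c) (a × c) ℂ →ₗ[ℂ] Matrix (b × d) (b × d) ℂ :=
  idTensor Ψ ∘ₗ tensorId Φ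

/-- The defining property of `Φ ⊗ Ψ`. -/
theorem tensorMap_kronecker (Φ : Matrix a a ℂ →ₗ[ℂ] Matrix b b ℂ)
    (Ψ : Matrix c c ℂ →ₗ[ℂ] Matrix d d ℂ) (X : Matrix a a ℂ) (Y : Matrix c c ℂ) :
    tensorMap Φ Ψ (X ⊗ₖ Y) = Φ X ⊗ₖ Ψ Y := by
  have h1 : tensorId Φ (X ⊗ₖ Y) = Φ X ⊗ₖ Y := by
    ext i j
    have : (Matrix.of fun p q => (X ⊗ₖ Y) (p, i.2) (q, j.2)) = Y i.2 j.2 • X := by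
      ext p q; simp [mul_comm]
    simp only [tensorId, LinearMap.coe_mk, AddHom.coe_mk, Matrix.of_apply, this, map_smul]
    simp [mul_comm]
  have h2 : idTensor Ψ (Φ X ⊗ₖ Y) = Φ X ⊗ₖ Ψ Y := by
    ext i j
    have : (Matrix.of fun p q => (Φ X ⊗ₖ Y) (i.1, p) (j.1, q)) = Φ X i.1 j.1 • Y := by
      ext p q; simp
    simp only [idTensor, LinearMap.coe_mk, AddHom.coe_mk, Matrix.of_apply, this, map_smul]
    simp
  simp [tensorMap, h1, h2]

/-- Complete positivity: `Φ ⊗ id_k` preserves positivity for every `k`. -/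
def IsCP [Fintype a] [Fintype b] (Φ : Matrix a a ℂ →ₗ[ℂ] Matrix b b ℂ) : Prop :=
  ∀ (k : ℕ) (X : Matrix (a × Fin k) (a × Fin k) ℂ), X.PosSemidef →
    (tensorId Φ X : Matrix (b × Fin k) (b × Fin k) ℂ).PosSemidef

/-- Completely positive trace preserving maps. -/
def IsCPTP [Fintype a] [Fintype b] (Φ : Matrix a a ℂ →ₗ[ℂ] Matrix b b ℂ) : Prop :=
  IsCP Φ ∧ ∀ X, (Φ X).trace = X.trace

/-- Conjugation `X ↦ K X K†`. -/
def conjMap [Fintype a] (K : Matrix b a ℂ) : Matrix a a ℂ →ₗ[ℂ] Matrix b b ℂ where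
  toFun X := K * X * K.conjTranspose
  map_add' X Y := by rw [Matrix.mul_add, Matrix.add_mul]
  map_smul' z X := by rw [Matrix.mul_smul, Matrix.smul_mul, RingHom.id_apply]

/-- The projector `|v⟩⟨v|`. -/
def proj (v : a → ℂ) : Matrix a a ℂ := Matrix.vecMulVec v (star v)

/-- The substitution map `X ↦ Tr(X) |v⟩⟨v|`. -/
def substMap [Fintype a] (v : b → ℂ) : Matrix a a ℂ →ₗ[ℂ] Matrix b b ℂ where
  toFun X := X.trace • proj v
  map_add' X Y := by rw [Matrix.trace_add, add_smul]
  map_smul' z X := by rw [Matrix.trace_smul, smul_assoc, RingHom.id_apply]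

end Basic

/-! ### Classes of operations of two senders

The first sender has dimension `m` and output dimension `n`, the second one `m'` and `n'`. -/

/-- The operators on `ℂ^m`. -/
abbrev Op (m : ℕ) : Type := Matrix (Fin m) (Fin m) ℂ

/-- The operators on `ℂ^m ⊗ ℂ^m'`. -/
abbrev Op₂ (m m' : ℕ) : Type := Matrix (Fin m × Fin m') (Fin m × Fin m') ℂ

/-- A quantum instrument with outcomes `Fin r`: completely positive maps with trace preserving sum.
The dimension of the post-measurement system may depend on the outcome. -/
def IsInstrument {m r : ℕ} {k : Fin r → ℕ} (E : ∀ i, Op m →ₗ[ℂ] Op (k i)) : Prop :=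
  (∀ i, IsCP (E i)) ∧ ∀ X, ∑ i, (E i X).trace = X.trace

/-- Local operations: `Λ = Λ₁ ⊗ Λ₂` with both factors CPTP. -/
def IsLO {m m' n n' : ℕ} (Λ : Op₂ m m' →ₗ[ℂ] Op₂ n n') : Prop :=
  ∃ (Λ₁ : Op m →ₗ[ℂ] Op n) (Λ₂ : Op m' →ₗ[ℂ] Op n'),
    IsCPTP Λ₁ ∧ IsCPTP Λ₂ ∧ Λ = tensorMap Λ₁ Λ₂

/-- Local operations and (two-way) classical communication, with finitely many rounds.
Either nothing is done, or one of the two parties performs a local instrument and announces the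
outcome `i`, after which both go on with an LOCC protocol `Λ i` that may depend on `i`. -/
inductive IsLOCC {n n' : ℕ} : ∀ {m m' : ℕ}, (Op₂ m m' →ₗ[ℂ] Op₂ n n') → Prop
  | done : IsLOCC (LinearMap.id : Op₂ n n' →ₗ[ℂ] Op₂ n n')
  | first {m m' r : ℕ} {k : Fin r → ℕ} (E : ∀ i, Op m →ₗ[ℂ] Op (k i)) (hE : IsInstrument E)
      (Λ : ∀ i, Op₂ (k i) m' →ₗ[ℂ] Op₂ n n') (hΛ : ∀ i, IsLOCC (Λ i)) :
      IsLOCC (∑ i, Λ i ∘ₗ tensorMap (E i) (LinearMap.id : Op m' →ₗ[ℂ] Op m'))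
  | second {m m' r : ℕ} {k : Fin r → ℕ} (E : ∀ i, Op m' →ₗ[ℂ] Op (k i)) (hE : IsInstrument E)
      (Λ : ∀ i, Op₂ m (k i) →ₗ[ℂ] Op₂ n n') (hΛ : ∀ i, IsLOCC (Λ i)) :
      IsLOCC (∑ i, Λ i ∘ₗ tensorMap (LinearMap.id : Op m →ₗ[ℂ] Op m) (E i))

/-- The operators on `A ⊗ A' ⊗ B`: two senders of dimensions `m`, `m'`, a receiver of
dimension `b`. -/
abbrev Op₃ (m m' b : ℕ) : Type :=
  Matrix ((Fin m × Fin m') × Fin b) ((Fin m × Fin m') × Fin b) ℂ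

/-- The quantum advantage of dense coding `Δ_O = S(ρ_B) - inf_{Λ ∈ O} S((Λ ⊗ id_B) ρ)`, where the
infimum runs over all maps in the class `O` on the senders' side, with arbitrary output
dimensions. It is taken in the extended reals, so that no convention on unbounded sets enters. -/
def advantage {m m' b : ℕ} (O : ∀ {n n' : ℕ}, (Op₂ m m' →ₗ[ℂ] Op₂ n n') → Prop)
    (ρ : Op₃ m m' b) : EReal :=
  (entropy (traceFst ρ) : EReal) -
    ⨅ (n : ℕ) (n' : ℕ) (Λ : Op₂ m m' →ₗ[ℂ] Op₂ n n') (_ : O Λ),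
      (entropy (tensorId Λ ρ : Op₃ n n' b) : EReal)

/-- An operator on `A ⊗ A' ⊗ B`, seen as a bipartite operator in the cut `A' : AB`. -/
def cutSecond {m m' b : ℕ} (ρ : Op₃ m m' b) :
    Matrix (Fin m' × (Fin m × Fin b)) (Fin m' × (Fin m × Fin b)) ℂ :=
  ρ.submatrix (fun x => ((x.2.1, x.1), x.2.2)) (fun x => ((x.2.1, x.1), x.2.2))

/-! ### The state and the protocol -/

/-- The computational basis of a qubit. -/
def ket (i : Fin 2) : Fin 2 → ℂ := Pi.single i 1

/-- `|φ₀⟩ = |0⟩_{A'} ⊗ (|00⟩_{AB} + |11⟩_{AB}) / √2`. -/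
def phi0 : (Fin 2 × Fin 2) × Fin 2 → ℂ := fun x =>
  ket 0 x.1.2 * ((1 / (Real.sqrt 2 : ℂ)) * (ket 0 x.1.1 * ket 0 x.2 + ket 1 x.1.1 * ket 1 x.2))

/-- `|φ₁⟩ = |1⟩_{A'} ⊗ (|01⟩_{AB} + |10⟩_{AB}) / √2`. -/
def phi1 : (Fin 2 × Fin 2) × Fin 2 → ℂ := fun x =>
  ket 1 x.1.2 * ((1 / (Real.sqrt 2 : ℂ)) * (ket 0 x.1.1 * ket 1 x.2 + ket 1 x.1.1 * ket 0 x.2))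

/-- `ρ_{AA'B} = (|φ₀⟩⟨φ₀| + |φ₁⟩⟨φ₁|) / 2`. -/
def rhoEx : Op₃ 2 2 2 := (1 / 2 : ℂ) • (proj phi0 + proj phi1)

/-- The correcting unitary of `A`: identity on outcome `0`, bit flip on outcome `1`. -/
def correction (i : Fin 2) : Op 2 := if i = 0 then 1 else !![0, 1; 1, 0]

/-- `A'` measures in the basis `{|0⟩, |1⟩}` and announces the outcome `i`; then `A` applies the
rotation `correction i` and `A'` is replaced by a system in the pure state `|0⟩`. -/
def protocol : Op₂ 2 2 →ₗ[ℂ] Op₂ 2 2 :=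
  ∑ i : Fin 2, tensorMap (conjMap (correction i)) (substMap (ket 0)) ∘ₗ
    tensorMap (LinearMap.id : Op 2 →ₗ[ℂ] Op 2) (conjMap (proj (ket i)))

end DenseCoding

end

open DenseCoding

namespace DenseCoding

open Matrix

/-! ### Rank-one projectors. -/

section Proj

variable {a b : Type*}

/-! The substantial claim is that local operations give no advantage; the others are computations
with explicit vectors. It rests on the fact that a separable operator has at least the entropy of
its marginal (`entropy_sum_le_entropy_sum_kronecker`), used twice. A product map keeps the state
separable in the cut `A' : AB`, so the total entropy is at least that of `AB`. The reduced state of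
`AB` is `(1 + X ⊗ X) / 4`, a mixture of `|++⟩` and `|−−⟩`; a channel on `A` keeps it separable and
leaves `B` maximally mixed, so the entropy of `AB` is at least 1. The identity map attains 1.

The entropy inequality comes from Gram matrices: `∑ proj (x k)` has the nonzero spectrum of the Gram
matrix of the `x k`, and tensoring with unit vectors `y k` multiplies that matrix entrywise by a
correlation matrix. This Schur multiplication is positive, unital and trace preserving, so the
spectra are related by a doubly stochastic matrix, and concavity of `-t log t` concludes
(`entropy_le_entropy_hadamard`).

With communication, the flag in `A'` tells `A` which Bell state is shared; correcting it gives a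
pure state, of entropy 0. -/

theorem proj_posSemidef [Finite a] (v : a → ℂ) : (proj v).PosSemidef :=
  posSemidef_vecMulVec_self_star v

theorem trace_proj [Fintype a] (v : a → ℂ) : (proj v).trace = star v ⬝ᵥ v := by
  rw [proj, trace_vecMulVec, dotProduct_comm]

theorem proj_kronecker_proj (x : a → ℂ) (y : b → ℂ) :
    proj x ⊗ₖ proj y = proj fun p : a × b => x p.1 * y p.2 := by
  ext p q
  simp [proj, vecMulVec_apply]
  ring

theorem proj_smul (c : ℂ) (x : a → ℂ) : proj (c • x) = (c * star c) • proj x := by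
  ext i j
  simp [proj, vecMulVec_apply]
  ring

theorem sum_proj_eq_mul_conjTranspose {K : Type*} [Fintype K] (x : K → a → ℂ) :
    ∑ k, proj (x k) = (of fun i k => x k i) * (of fun i k => x k i : Matrix a K ℂ)ᴴ := by
  ext i j
  simp [Matrix.sum_apply, proj, vecMulVec_apply, mul_apply]

end Proj

/-! ### Entropy, spectra and separable operators. -/

section Spectral

variable {a b K : Type*} [Fintype a] [DecidableEq a] [Fintype b] [DecidableEq b]
  [Fintype K] [DecidableEq K]

theorem entropy_eq_sum_eigenvalues {A : Matrix a a ℂ} (hA : A.IsHermitian) :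
    entropy A = (∑ i, Real.negMulLog (hA.eigenvalues i)) / Real.log 2 := by
  rw [entropy, dif_pos hA, Finset.sum_div, ← Finset.sum_neg_distrib]
  refine Finset.sum_congr rfl fun i _ => ?_
  rw [Real.negMulLog, Real.logb]
  ring

/-- Makes the entropy a function of the characteristic polynomial alone, so eigenvalue enumerations
need not be matched. -/
theorem entropy_eq_sum_roots {A : Matrix a a ℂ} (hA : A.IsHermitian) :
    entropy A = (A.charpoly.roots.map fun z => Real.negMulLog z.re).sum / Real.log 2 := by
  rw [entropy_eq_sum_eigenvalues hA, hA.roots_charpoly_eq_eigenvalues, Multiset.map_map]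
  rfl

/-- `M M†` and `M† M` have the same nonzero spectrum, hence the same entropy. -/
theorem entropy_mul_conjTranspose (M : Matrix a K ℂ) :
    entropy (M * Mᴴ) = entropy (Mᴴ * M) := by
  have h := congrArg Polynomial.roots (charpoly_mul_comm' M Mᴴ)
  have hX : ∀ n : ℕ, (Polynomial.X ^ n : Polynomial ℂ) ≠ 0 := fun n =>
    pow_ne_zero _ Polynomial.X_ne_zero
  rw [Polynomial.roots_mul (mul_ne_zero (hX _) (charpoly_monic _).ne_zero),
    Polynomial.roots_mul (mul_ne_zero (hX _) (charpoly_monic _).ne_zero),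
    Polynomial.roots_X_pow, Polynomial.roots_X_pow] at h
  -- The two root multisets differ only by zeros, which contribute `negMulLog 0 = 0`.
  have h2 := congrArg (fun s => (s.map fun z : ℂ => Real.negMulLog z.re).sum) h
  simp only [Multiset.map_add, Multiset.sum_add, Multiset.map_nsmul, Multiset.sum_nsmul,
    Multiset.map_singleton, Multiset.sum_singleton, Complex.zero_re, Real.negMulLog_zero,
    smul_zero, zero_add] at h2
  rw [entropy_eq_sum_roots (isHermitian_mul_conjTranspose_self M),
    entropy_eq_sum_roots (isHermitian_conjTranspose_mul_self M), h2]

theorem entropy_submatrix {A : Matrix a a ℂ} (hA : A.IsHermitian) (e : b ≃ a) :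
    entropy (A.submatrix e e) = entropy A := by
  rw [entropy_eq_sum_roots hA, entropy_eq_sum_roots (hA.submatrix e)]
  have : A.submatrix e e = reindex e.symm e.symm A := rfl
  rw [this, charpoly_reindex]

theorem entropy_smul_one {t : ℝ} :
    entropy ((t : ℂ) • (1 : Matrix a a ℂ)) = Fintype.card a * Real.negMulLog t / Real.log 2 := by
  have h : (t : ℂ) • (1 : Matrix a a ℂ) = diagonal fun _ => (t : ℂ) := by
    ext i j; simp [one_apply, diagonal_apply]
  have hh : (diagonal fun _ : a => (t : ℂ)).IsHermitian := by
    rw [isHermitian_diagonal_iff]; intro i; simp [IsSelfAdjoint]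
  rw [h, entropy_eq_sum_roots hh, charpoly_diagonal, Polynomial.roots_prod]
  · simp
  · simp [Polynomial.X_sub_C_ne_zero]

/-- Spectral decomposition into rank-one projectors. -/
theorem exists_spectral_decomposition {A : Matrix a a ℂ} (hA : A.IsHermitian) :
    ∃ v : a → a → ℂ, A = ∑ j, (hA.eigenvalues j : ℂ) • proj (v j) ∧
      ∑ j, proj (v j) = (1 : Matrix a a ℂ) ∧
      (∀ i, star (v i) ⬝ᵥ v i = 1) ∧ ∀ i, star (v i) ⬝ᵥ (A *ᵥ v i) = hA.eigenvalues i := by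
  let U : Matrix a a ℂ := (hA.eigenvectorUnitary : Matrix a a ℂ)
  have h1 : star U * U = 1 := Unitary.coe_star_mul_self hA.eigenvectorUnitary
  have h2 : U * star U = 1 := Unitary.coe_mul_star_self hA.eigenvectorUnitary
  have h3 : ∀ i, star (fun k => U k i) ⬝ᵥ (fun k => U k i) = 1 := fun i => by
    have := congrFun (congrFun h1 i) i
    simpa [mul_apply, dotProduct, star_eq_conjTranspose] using this
  refine ⟨fun j i => U i j, ?_, ?_, h3, fun i => ?_⟩
  · have h := hA.spectral_theorem
    rw [Unitary.conjStarAlgAut_apply] at h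
    conv_lhs => rw [h]
    ext i j
    simp only [mul_apply, diagonal_apply, Matrix.sum_apply, Matrix.smul_apply, proj, vecMulVec_apply]
    simp only [mul_ite, mul_zero, Finset.sum_ite_eq', Finset.mem_univ, if_true]
    refine Finset.sum_congr rfl fun k _ => ?_
    simp [U]
    ring
  · rw [← h2]
    ext i j
    simp [mul_apply, Matrix.sum_apply, proj, vecMulVec_apply, star_eq_conjTranspose]
  · have h := hA.mulVec_eigenvectorBasis i
    have h4 : (fun k => U k i) = ⇑(hA.eigenvectorBasis i) := by
      ext k; simp [U]
    change star (fun k => U k i) ⬝ᵥ (A *ᵥ fun k => U k i) = _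
    rw [h4, h, ← h4, dotProduct_smul, h3]
    simp

/-- Schur multiplication by a correlation matrix does not decrease the entropy. -/
theorem entropy_le_entropy_hadamard {G Y : Matrix a a ℂ} (hG : G.PosSemidef)
    (hY : Y.PosSemidef) (hY1 : ∀ k, Y k k = 1) : entropy G ≤ entropy (G ⊙ Y) := by
  have hH := hG.hadamard hY
  obtain ⟨v, hv, hv1, hvn, -⟩ := exists_spectral_decomposition hG.isHermitian
  obtain ⟨u, -, hu1, hun, hu⟩ := exists_spectral_decomposition hH.isHermitian
  -- Diagonal entries of `X ⊙ Y` in the eigenbasis of `G ⊙ Y`. On the eigenprojectors of `G` they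
  -- form the matrix `D`.
  let F : a → Matrix a a ℂ →ₗ[ℂ] ℂ := fun i =>
    { toFun := fun X => star (u i) ⬝ᵥ ((X ⊙ Y) *ᵥ u i)
      map_add' := fun X Z => by rw [add_hadamard, add_mulVec, dotProduct_add]
      map_smul' := fun c X => by rw [smul_hadamard, smul_mulVec, dotProduct_smul]; rfl }
  have hF : ∀ i X, F i X = star (u i) ⬝ᵥ ((X ⊙ Y) *ᵥ u i) := fun _ _ => rfl
  have hF0 : ∀ i j, 0 ≤ F i (proj (v j)) := fun i j =>
    ((proj_posSemidef (v j)).hadamard hY).dotProduct_mulVec_nonneg (u i)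
  have hsum : ∀ X : Matrix a a ℂ, ∑ i, F i X = (X ⊙ Y).trace := fun X => by
    have : ∀ i, F i X = ((X ⊙ Y) * proj (u i)).trace := fun i => by
      rw [hF, proj, mul_vecMulVec, trace_vecMulVec, dotProduct_comm]
    simp_rw [this]
    rw [← trace_sum, ← Matrix.mul_sum, hu1, mul_one]
  have hdiag : ∀ X : Matrix a a ℂ, (X ⊙ Y).trace = X.trace := fun X => by
    simp [trace, hadamard_apply, hY1]
  let D : a → a → ℝ := fun i j => (F i (proj (v j))).re
  have hDF : ∀ i j, F i (proj (v j)) = (D i j : ℂ) := fun i j =>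
    Complex.ext rfl (by simpa using (Complex.nonneg_iff.1 (hF0 i j)).2.symm)
  have hD0 : ∀ i j, 0 ≤ D i j := fun i j => (Complex.nonneg_iff.1 (hF0 i j)).1
  -- Rows sum to 1 because Schur multiplication by `Y` is unital, columns because it preserves the
  -- trace.
  have hrow : ∀ i, ∑ j, D i j = 1 := fun i => by
    have h : F i 1 = 1 := by
      have h1 : (1 : Matrix a a ℂ) ⊙ Y = 1 := one_hadamard_eq_one_iff.2 (funext hY1)
      rw [hF, h1, one_mulVec, hun]
    rw [← hv1, map_sum] at h
    simp_rw [hDF] at h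
    exact_mod_cast h
  have hcol : ∀ j, ∑ i, D i j = 1 := fun j => by
    have h := hsum (proj (v j))
    rw [hdiag, trace_proj, hvn] at h
    simp_rw [hDF] at h
    exact_mod_cast h
  have hmu : ∀ i, hH.isHermitian.eigenvalues i = ∑ j, D i j * hG.isHermitian.eigenvalues j := by
    intro i
    have h : F i G = hH.isHermitian.eigenvalues i := by rw [hF, hu]
    conv_lhs at h => rw [hv, map_sum]
    simp_rw [map_smul, hDF, smul_eq_mul] at h
    have h' := congrArg Complex.re h
    rw [Complex.ofReal_re] at h'
    rw [← h', Complex.re_sum]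
    refine Finset.sum_congr rfl fun j _ => ?_
    rw [← Complex.ofReal_mul, Complex.ofReal_re, mul_comm]
  rw [entropy_eq_sum_eigenvalues hG.isHermitian, entropy_eq_sum_eigenvalues hH.isHermitian]
  refine div_le_div_of_nonneg_right ?_ (Real.log_nonneg one_le_two)
  calc ∑ j, Real.negMulLog (hG.isHermitian.eigenvalues j)
      = ∑ j, (∑ i, D i j) * Real.negMulLog (hG.isHermitian.eigenvalues j) := by
        simp [hcol]
    _ = ∑ i, ∑ j, D i j • Real.negMulLog (hG.isHermitian.eigenvalues j) := by
        simp_rw [Finset.sum_mul, smul_eq_mul]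
        exact Finset.sum_comm
    _ ≤ ∑ i, Real.negMulLog (hH.isHermitian.eigenvalues i) := by
        refine Finset.sum_le_sum fun i _ => ?_
        have h := Real.concaveOn_negMulLog.le_map_sum (t := Finset.univ) (w := D i)
          (p := hG.isHermitian.eigenvalues) (fun j _ => hD0 i j) (hrow i)
          (fun j _ => hG.eigenvalues_nonneg j)
        refine h.trans_eq ?_
        rw [hmu i]
        rfl

/-- The Gram matrix of the vectors `x k ⊗ y k` is the Hadamard product of the two Gram matrices, and
that of the `y k` has unit diagonal. -/
theorem entropy_sum_proj_le (x : K → a → ℂ) (y : K → b → ℂ) (hy : ∀ k, star (y k) ⬝ᵥ y k = 1) :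
    entropy (∑ k, proj (x k)) ≤ entropy (∑ k, proj (x k) ⊗ₖ proj (y k)) := by
  simp_rw [proj_kronecker_proj]
  rw [sum_proj_eq_mul_conjTranspose, sum_proj_eq_mul_conjTranspose, entropy_mul_conjTranspose,
    entropy_mul_conjTranspose]
  let Y : Matrix K K ℂ := (of fun i k => y k i : Matrix b K ℂ)ᴴ * (of fun i k => y k i)
  have h := entropy_le_entropy_hadamard (posSemidef_conjTranspose_mul_self
    (of fun i k => x k i : Matrix a K ℂ)) (posSemidef_conjTranspose_mul_self
    (of fun i k => y k i : Matrix b K ℂ)) (fun k => by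
      simpa [mul_apply, dotProduct] using hy k)
  refine h.trans_eq (congrArg entropy ?_)
  ext k l
  simp only [hadamard_apply, mul_apply, conjTranspose_apply, of_apply, star_mul',
    Fintype.sum_prod_type, Finset.sum_mul_sum]
  refine Finset.sum_congr rfl fun i _ => Finset.sum_congr rfl fun j _ => ?_
  ring

/-- The entropy of a separable operator is at least the entropy of its first marginal. -/
theorem entropy_sum_le_entropy_sum_kronecker {ω : K → Matrix a a ℂ} {τ : K → Matrix b b ℂ}
    (hω : ∀ i, (ω i).PosSemidef) (hτ : ∀ i, IsDensity (τ i)) :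
    entropy (∑ i, ω i) ≤ entropy (∑ i, ω i ⊗ₖ τ i) := by
  choose v hv using fun i => exists_spectral_decomposition (hω i).isHermitian
  choose w hw using fun i => exists_spectral_decomposition (hτ i).1.isHermitian
  let s : K → a → ℝ := fun i => (hω i).isHermitian.eigenvalues
  let t : K → b → ℝ := fun i => (hτ i).1.isHermitian.eigenvalues
  have hs : ∀ i k, 0 ≤ s i k := fun i k => (hω i).eigenvalues_nonneg k
  have ht : ∀ i k, 0 ≤ t i k := fun i k => (hτ i).1.eigenvalues_nonneg k
  have ht1 : ∀ i, ∑ l, (t i l : ℂ) = 1 := fun i =>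
    (hτ i).1.isHermitian.trace_eq_sum_eigenvalues.symm.trans (hτ i).2
  -- All the spectral weight goes into `x`, so that the vectors of the second factor stay
  -- normalized.
  let x : K × a × b → a → ℂ := fun p =>
    ((Real.sqrt (s p.1 p.2.1 * t p.1 p.2.2) : ℝ) : ℂ) • v p.1 p.2.1
  have hx : ∀ p, proj (x p) = ((s p.1 p.2.1 : ℂ) * (t p.1 p.2.2 : ℂ)) • proj (v p.1 p.2.1) := by
    intro p
    rw [proj_smul]
    congr 1
    rw [Complex.star_def, Complex.conj_ofReal, ← Complex.ofReal_mul,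
      Real.mul_self_sqrt (mul_nonneg (hs _ _) (ht _ _)), Complex.ofReal_mul]
  have h := entropy_sum_proj_le x (fun p => w p.1 p.2.2) (fun p => (hw p.1).2.2.1 p.2.2)
  have h1 : ∑ p, proj (x p) = ∑ i, ω i := by
    simp_rw [hx, Fintype.sum_prod_type, mul_comm (s _ _ : ℂ), mul_smul]
    refine Finset.sum_congr rfl fun i _ => ?_
    rw [Finset.sum_comm]
    simp_rw [← Finset.smul_sum]
    rw [← (hv i).1, ← Finset.sum_smul, ht1, one_smul]
  have h2 : ∑ p, proj (x p) ⊗ₖ proj (w p.1 p.2.2) = ∑ i, ω i ⊗ₖ τ i := by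
    simp_rw [hx, Fintype.sum_prod_type]
    refine Finset.sum_congr rfl fun i _ => ?_
    ext p q
    conv_rhs => rw [(hv i).1, (hw i).1]
    simp only [Matrix.sum_apply, kroneckerMap_apply, Matrix.smul_apply, smul_eq_mul, Finset.sum_mul_sum]
    refine Finset.sum_congr rfl fun _ _ => Finset.sum_congr rfl fun _ _ => ?_
    ring
  rwa [h1, h2] at h

end Spectral

/-! ### Tensor products of maps, complete positivity, channels. -/

section Maps

variable {a b c d e f : Type*}

theorem tensorId_kronecker (Φ : Matrix a a ℂ →ₗ[ℂ] Matrix b b ℂ) (X : Matrix a a ℂ)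
    (Y : Matrix c c ℂ) : tensorId Φ (X ⊗ₖ Y) = Φ X ⊗ₖ Y :=
  tensorMap_kronecker Φ LinearMap.id X Y

theorem tensorId_comp (Φ : Matrix b b ℂ →ₗ[ℂ] Matrix c c ℂ) (Ψ : Matrix a a ℂ →ₗ[ℂ] Matrix b b ℂ)
    (X : Matrix (a × d) (a × d) ℂ) : tensorId (Φ ∘ₗ Ψ) X = tensorId Φ (tensorId Ψ X) := rfl

theorem tensorId_sum {ι : Type*} [Fintype ι] (Φ : ι → Matrix a a ℂ →ₗ[ℂ] Matrix b b ℂ)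
    (X : Matrix (a × c) (a × c) ℂ) : tensorId (∑ i, Φ i) X = ∑ i, tensorId (Φ i) X := by
  ext p q
  simp [tensorId, Matrix.sum_apply]

/-- The product of an operator on `A ⊗ B` and an operator on `A'`, as an operator on
`(A ⊗ A') ⊗ B`. -/
def interleave (ω : Matrix (a × c) (a × c) ℂ) (τ : Matrix b b ℂ) :
    Matrix ((a × b) × c) ((a × b) × c) ℂ :=
  (ω ⊗ₖ τ).submatrix (fun x => ((x.1.1, x.2), x.1.2)) fun x => ((x.1.1, x.2), x.1.2)

theorem tensorId_tensorMap_interleave (Φ : Matrix a a ℂ →ₗ[ℂ] Matrix b b ℂ)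
    (Ψ : Matrix c c ℂ →ₗ[ℂ] Matrix d d ℂ) (ω : Matrix (a × e) (a × e) ℂ) (τ : Matrix c c ℂ) :
    tensorId (tensorMap Φ Ψ) (interleave ω τ) = interleave (tensorId Φ ω) (Ψ τ) := by
  ext i j
  exact congrFun (congrFun (tensorMap_kronecker Φ Ψ
    (of fun p q => ω (p, i.2) (q, j.2)) τ) i.1) j.1

theorem interleave_zero (ω : Matrix (a × c) (a × c) ℂ) :
    interleave ω (0 : Matrix b b ℂ) = 0 := by
  ext i j
  simp [interleave]

theorem interleave_proj (x : a × c → ℂ) (y : b → ℂ) :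
    interleave (proj x) (proj y) = proj fun p => x (p.1.1, p.2) * y p.1.2 := by
  rw [interleave, proj_kronecker_proj]
  rfl

variable [Fintype a]

theorem tensorId_conjMap [Fintype c] [DecidableEq c] (K : Matrix b a ℂ)
    (X : Matrix (a × c) (a × c) ℂ) :
    tensorId (conjMap K) X = (K ⊗ₖ (1 : Matrix c c ℂ)) * X * (K ⊗ₖ (1 : Matrix c c ℂ))ᴴ := by
  ext i j
  simp [tensorId, conjMap, mul_apply, Fintype.sum_prod_type, one_apply, Finset.sum_mul]
  refine Finset.sum_congr rfl fun x _ => ?_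
  rw [Finset.sum_comm]
  simp [apply_ite (starRingEnd ℂ)]

theorem conjMap_proj (K : Matrix b a ℂ) (v : a → ℂ) : conjMap K (proj v) = proj (K *ᵥ v) := by
  change K * vecMulVec v (star v) * Kᴴ = vecMulVec (K *ᵥ v) (star (K *ᵥ v))
  rw [mul_vecMulVec, vecMulVec_mul, star_mulVec]

variable [Fintype b]

theorem isCP_conjMap (K : Matrix b a ℂ) : IsCP (conjMap K) := fun k X hX => by
  rw [tensorId_conjMap]
  exact hX.mul_mul_conjTranspose_same _

theorem isCP_sum {ι : Type*} [Fintype ι] {Φ : ι → Matrix a a ℂ →ₗ[ℂ] Matrix b b ℂ}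
    (h : ∀ i, IsCP (Φ i)) : IsCP (∑ i, Φ i) := fun k X hX => by
  rw [tensorId_sum]
  exact posSemidef_sum _ fun i _ => h i k X hX

theorem isCPTP_id : IsCPTP (LinearMap.id : Matrix a a ℂ →ₗ[ℂ] Matrix a a ℂ) :=
  ⟨fun _ _ hX => hX, fun _ => rfl⟩

theorem isCPTP_conjMap [DecidableEq a] {K : Matrix b a ℂ} (hK : Kᴴ * K = 1) :
    IsCPTP (conjMap K) :=
  ⟨isCP_conjMap K, fun X => by
    change (K * X * Kᴴ).trace = X.trace
    rw [trace_mul_cycle, hK, one_mul]⟩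

theorem isCPTP_substMap [DecidableEq a] {v : b → ℂ} (hv : star v ⬝ᵥ v = 1) :
    IsCPTP (substMap v : Matrix a a ℂ →ₗ[ℂ] Matrix b b ℂ) := by
  refine ⟨?_, fun X => ?_⟩
  · have h : (substMap v : Matrix a a ℂ →ₗ[ℂ] Matrix b b ℂ) =
        ∑ j, conjMap (vecMulVec v (Pi.single j 1)) := by
      ext1 X
      rw [LinearMap.sum_apply]
      ext p q
      simp [substMap, conjMap, Matrix.sum_apply, mul_apply, proj, vecMulVec_apply, trace,
        Pi.single_apply, Finset.sum_mul]
      refine Finset.sum_congr rfl fun j _ => ?_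
      ring
    rw [h]
    exact isCP_sum fun j => isCP_conjMap _
  · change (X.trace • proj v).trace = X.trace
    rw [trace_smul, trace_proj, hv, smul_eq_mul, mul_one]

theorem IsCPTP.isDensity {Φ : Matrix a a ℂ →ₗ[ℂ] Matrix b b ℂ} (h : IsCPTP Φ) {X : Matrix a a ℂ}
    (hX : IsDensity X) : IsDensity (Φ X) := by
  refine ⟨?_, (h.2 X).trans hX.2⟩
  -- Positivity of `Φ` is complete positivity with a one-dimensional ancilla.
  have h1 := h.1 1 (X ⊗ₖ (1 : Matrix (Fin 1) (Fin 1) ℂ)) (hX.1.kronecker PosSemidef.one)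
  rw [tensorId_kronecker] at h1
  have h2 := h1.submatrix fun i : b => (i, (0 : Fin 1))
  convert h2 using 1
  ext i j
  simp

theorem isDensity_proj {v : a → ℂ} (hv : star v ⬝ᵥ v = 1) : IsDensity (proj v) :=
  ⟨proj_posSemidef v, by rw [trace_proj, hv]⟩

end Maps

/-! ### Local operations as one-outcome LOCC rounds. -/

section LOCC

theorem IsCPTP.isInstrument {m n : ℕ} {Φ : Op m →ₗ[ℂ] Op n} (h : IsCPTP Φ) :
    IsInstrument (k := fun _ : Fin 1 => n) fun _ => Φ :=
  ⟨fun _ => h.1, fun X => by simpa using h.2 X⟩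

/-- A local operation is LOCC. -/
theorem isLOCC_tensorMap {m m' n n' : ℕ} {Φ : Op m →ₗ[ℂ] Op n} {Ψ : Op m' →ₗ[ℂ] Op n'}
    (hΦ : IsCPTP Φ) (hΨ : IsCPTP Ψ) : IsLOCC (tensorMap Φ Ψ) := by
  have h1 := IsLOCC.second (m := n) (fun _ : Fin 1 => Ψ) hΨ.isInstrument
    (fun _ => LinearMap.id) fun _ => IsLOCC.done
  have h2 := IsLOCC.first (m' := m') (fun _ : Fin 1 => Φ) hΦ.isInstrument _ fun _ => h1
  rw [Fin.sum_univ_one, Fin.sum_univ_one] at h2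
  exact h2

end LOCC

/-! ### Entropy of flat spectra. -/

section Entropy

variable {a K : Type*} [Fintype a] [DecidableEq a] [Fintype K] [DecidableEq K]

/-- The entropy of a multiple of a sum of orthogonal rank-one projectors. -/
theorem entropy_smul_sum_proj {t : ℝ} (ht : 0 ≤ t) (x : K → a → ℂ)
    (hx : ∀ k l, star (x k) ⬝ᵥ x l = if k = l then 1 else 0) :
    entropy ((t : ℂ) • ∑ k, proj (x k)) = Fintype.card K * Real.negMulLog t / Real.log 2 := by
  have hs : ((Real.sqrt t : ℝ) : ℂ) * star ((Real.sqrt t : ℝ) : ℂ) = t := by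
    rw [Complex.star_def, Complex.conj_ofReal, ← Complex.ofReal_mul, Real.mul_self_sqrt ht]
  have h : (t : ℂ) • ∑ k, proj (x k) = ∑ k, proj (((Real.sqrt t : ℝ) : ℂ) • x k) := by
    simp_rw [proj_smul, hs, Finset.smul_sum]
  -- By orthonormality the Gram matrix of the rescaled vectors is `t` times the identity on `K`.
  rw [h, sum_proj_eq_mul_conjTranspose, entropy_mul_conjTranspose, ← entropy_smul_one]
  congr 1
  ext k l
  have h2 := hx k l
  simp only [dotProduct, Pi.star_apply] at h2
  simp only [mul_apply, conjTranspose_apply, of_apply, Pi.smul_apply, smul_eq_mul, star_mul',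
    Matrix.smul_apply, one_apply, ← h2, ← hs, Finset.mul_sum]
  refine Finset.sum_congr rfl fun i _ => ?_
  ring

theorem two_mul_negMulLog_half : ((2 : ℕ) : ℝ) * Real.negMulLog (1 / 2) / Real.log 2 = 1 := by
  have : Real.log 2 ≠ 0 := (Real.log_pos one_lt_two).ne'
  rw [Real.negMulLog, one_div, Real.log_inv]
  field_simp
  norm_num

end Entropy

/-! ### The example state and its separability. -/

section Example

/-- The Bell vectors `(|0⟩|i⟩ + |1⟩|1 + i⟩) / √2`. -/
noncomputable def bell (i : Fin 2) : Fin 2 × Fin 2 → ℂ := fun x =>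
  (1 / (Real.sqrt 2 : ℂ)) * if x.2 = x.1 + i then 1 else 0

/-- The vectors `(|0⟩ ± |1⟩) / √2`. -/
noncomputable def hadamardKet (i : Fin 2) : Fin 2 → ℂ := fun x =>
  (1 / (Real.sqrt 2 : ℂ)) * if i = 1 ∧ x = 1 then -1 else 1

theorem inv_sqrt_two_mul_self : ((Real.sqrt 2 : ℂ))⁻¹ * ((Real.sqrt 2 : ℂ))⁻¹ = 2⁻¹ := by
  rw [← mul_inv, ← Complex.ofReal_mul, Real.mul_self_sqrt zero_le_two, Complex.ofReal_ofNat]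

theorem proj_bell (i : Fin 2) :
    proj (bell i) = of fun p q => if p.2 = p.1 + i ∧ q.2 = q.1 + i then 2⁻¹ else 0 := by
  ext p q
  simp only [proj, vecMulVec_apply, bell, Pi.star_apply, of_apply]
  split_ifs <;> simp_all [inv_sqrt_two_mul_self]

theorem proj_hadamardKet (i : Fin 2) :
    proj (hadamardKet i) = of fun p q => if i = 1 ∧ p ≠ q then -2⁻¹ else 2⁻¹ := by
  ext p q
  fin_cases i <;> fin_cases p <;> fin_cases q <;>
    simp [proj, vecMulVec_apply, hadamardKet, inv_sqrt_two_mul_self]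

theorem proj_ket (i : Fin 2) :
    proj (ket i) = of fun p q => if p = i ∧ q = i then 1 else 0 := by
  ext p q
  fin_cases i <;> fin_cases p <;> fin_cases q <;> simp [proj, vecMulVec_apply, ket]

theorem star_ket_dotProduct (i j : Fin 2) : star (ket i) ⬝ᵥ ket j = if i = j then 1 else 0 := by
  fin_cases i <;> fin_cases j <;> simp [dotProduct, ket]

theorem star_hadamardKet_dotProduct (i : Fin 2) :
    star (hadamardKet i) ⬝ᵥ hadamardKet i = 1 := by
  rw [← trace_proj, proj_hadamardKet]
  norm_num [trace]

theorem star_bell_dotProduct (i : Fin 2) : star (bell i) ⬝ᵥ bell i = 1 := by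
  rw [← trace_proj, proj_bell]
  fin_cases i <;> norm_num [trace, Fintype.sum_prod_type]

/-- The vectors `|φ₀⟩` and `|φ₁⟩`. -/
noncomputable def phi (i : Fin 2) : (Fin 2 × Fin 2) × Fin 2 → ℂ := fun x =>
  bell i (x.1.1, x.2) * ket i x.1.2

theorem phi_zero : phi 0 = phi0 := by
  ext ⟨⟨i, j⟩, k⟩
  fin_cases i <;> fin_cases j <;> fin_cases k <;> simp [phi, phi0, bell, ket]

theorem phi_one : phi 1 = phi1 := by
  ext ⟨⟨i, j⟩, k⟩
  fin_cases i <;> fin_cases j <;> fin_cases k <;> simp [phi, phi1, bell, ket]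

theorem proj_phi (i : Fin 2) : proj (phi i) = interleave (proj (bell i)) (proj (ket i)) :=
  (interleave_proj _ _).symm

theorem star_phi_dotProduct (i j : Fin 2) : star (phi i) ⬝ᵥ phi j = if i = j then 1 else 0 := by
  have h : star (phi i) ⬝ᵥ phi j = (star (bell i) ⬝ᵥ bell j) * (star (ket i) ⬝ᵥ ket j) := by
    simp only [dotProduct, phi, Pi.star_apply, star_mul', Fintype.sum_prod_type, Fin.sum_univ_two]
    ring
  rw [h, star_ket_dotProduct]
  split_ifs with hij
  · rw [hij, star_bell_dotProduct, one_mul]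
  · rw [mul_zero]

theorem rhoEx_eq : rhoEx = ((1 / 2 : ℝ) : ℂ) • ∑ i, proj (phi i) := by
  rw [Fin.sum_univ_two, phi_zero, phi_one, rhoEx]
  norm_num

theorem isDensity_rhoEx : IsDensity rhoEx := by
  rw [rhoEx_eq]
  refine ⟨(posSemidef_sum _ fun i _ => proj_posSemidef _).smul ?_, ?_⟩
  · exact_mod_cast (by norm_num : (0 : ℝ) ≤ 1 / 2)
  · rw [trace_smul, trace_sum]
    simp [trace_proj, star_phi_dotProduct]

theorem entropy_rhoEx : entropy rhoEx = 1 := by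
  rw [rhoEx_eq, entropy_smul_sum_proj (by norm_num) phi star_phi_dotProduct, Fintype.card_fin,
    two_mul_negMulLog_half]

theorem entropy_proj {a : Type*} [Fintype a] [DecidableEq a] {v : a → ℂ}
    (hv : star v ⬝ᵥ v = 1) : entropy (proj v) = 0 := by
  have h := entropy_smul_sum_proj zero_le_one (fun _ : Unit => v) fun k l => by simpa using hv
  simpa using h

theorem entropy_half_smul_one : entropy (((1 / 2 : ℝ) : ℂ) • (1 : Op 2)) = 1 := by
  rw [entropy_smul_one, Fintype.card_fin, two_mul_negMulLog_half]

theorem traceFst_proj_phi (i : Fin 2) :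
    traceFst (proj (phi i)) = ((1 / 2 : ℝ) : ℂ) • (1 : Op 2) := by
  rw [proj_phi, proj_bell, proj_ket]
  ext p q
  fin_cases i <;> fin_cases p <;> fin_cases q <;>
    simp [traceFst, interleave, Fintype.sum_prod_type]

theorem traceFst_rhoEx : traceFst rhoEx = ((1 / 2 : ℝ) : ℂ) • (1 : Op 2) := by
  have h : traceFst rhoEx = ((1 / 2 : ℝ) : ℂ) • ∑ i, traceFst (proj (phi i)) := by
    rw [rhoEx_eq]
    ext p q
    simp [traceFst, ← Finset.mul_sum, ← Finset.sum_add_distrib]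
  rw [h]
  simp_rw [traceFst_proj_phi]
  rw [Fin.sum_univ_two, ← add_smul]
  norm_num

theorem cutSecond_rhoEx :
    cutSecond rhoEx = ∑ i, ((1 / 2 : ℝ) : ℂ) • (proj (ket i) ⊗ₖ proj (bell i)) := by
  rw [rhoEx_eq]
  ext p q
  simp [cutSecond, proj_phi, interleave, mul_comm]

theorem traceFst_cutSecond_rhoEx :
    traceFst (cutSecond rhoEx) = ((1 / 2 : ℝ) : ℂ) • ∑ i, proj (bell i) := by
  rw [cutSecond_rhoEx]
  ext p q
  simp [traceFst, proj_ket, mul_add]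

/-- The average of the two Bell projectors is separable. -/
theorem smul_sum_proj_bell :
    ((1 / 2 : ℝ) : ℂ) • ∑ i, proj (bell i) =
      ∑ i, ((1 / 2 : ℝ) : ℂ) • (proj (hadamardKet i) ⊗ₖ proj (hadamardKet i)) := by
  -- Both sides equal `(1 + X ⊗ X) / 4`, since the projectors on `|±⟩` are `(1 ± X) / 2`.
  simp_rw [proj_bell, proj_hadamardKet]
  ext ⟨p, p'⟩ ⟨q, q'⟩
  fin_cases p <;> fin_cases p' <;> fin_cases q <;> fin_cases q' <;>
    norm_num [show (1 : Fin 2) + 1 = 0 from rfl]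

theorem isSepState_cutSecond_rhoEx : IsSepState (cutSecond rhoEx) :=
  ⟨2, fun _ => 1 / 2, fun i => proj (ket i), fun i => proj (bell i), fun _ => by norm_num,
    by norm_num, fun i => isDensity_proj (by rw [star_ket_dotProduct, if_pos rfl]),
    fun i => isDensity_proj (star_bell_dotProduct i), cutSecond_rhoEx⟩

theorem isSepState_traceFst_cutSecond_rhoEx : IsSepState (traceFst (cutSecond rhoEx)) :=
  ⟨2, fun _ => 1 / 2, fun i => proj (hadamardKet i), fun i => proj (hadamardKet i),
    fun _ => by norm_num, by norm_num, fun i => isDensity_proj (star_hadamardKet_dotProduct i),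
    fun i => isDensity_proj (star_hadamardKet_dotProduct i),
    traceFst_cutSecond_rhoEx.trans smul_sum_proj_bell⟩

/-- Local operations do not bring the entropy below that of the receiver. -/
theorem one_le_entropy_of_isLO {n n' : ℕ} {Λ : Op₂ 2 2 →ₗ[ℂ] Op₂ n n'} (h : IsLO Λ) :
    1 ≤ entropy (tensorId Λ rhoEx : Op₃ n n' 2) := by
  obtain ⟨Λ₁, Λ₂, h₁, h₂, rfl⟩ := h
  have hhalf : (0 : ℂ) ≤ ((1 / 2 : ℝ) : ℂ) := by
    exact_mod_cast (by norm_num : (0 : ℝ) ≤ 1 / 2)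
  let ω : Fin 2 → Matrix (Fin n × Fin 2) (Fin n × Fin 2) ℂ := fun i =>
    ((1 / 2 : ℝ) : ℂ) • tensorId Λ₁ (proj (bell i))
  -- Complete positivity of `Λ₁`, with the receiver's qubit as the ancilla.
  have hω : ∀ i, (ω i).PosSemidef := fun i => (h₁.1 2 _ (proj_posSemidef _)).smul hhalf
  have hτ : ∀ i, IsDensity (Λ₂ (proj (ket i))) := fun i =>
    h₂.isDensity (isDensity_proj (by rw [star_ket_dotProduct, if_pos rfl]))
  have hη : ∀ i, IsDensity (Λ₁ (proj (hadamardKet i))) := fun i =>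
    h₁.isDensity (isDensity_proj (star_hadamardKet_dotProduct i))
  let e : (Fin n × Fin n') × Fin 2 ≃ (Fin n × Fin 2) × Fin n' :=
    { toFun := fun x => ((x.1.1, x.2), x.1.2)
      invFun := fun x => ((x.1.1, x.2), x.1.2)
      left_inv := fun _ => rfl
      right_inv := fun _ => rfl }
  have hσ : (tensorId (tensorMap Λ₁ Λ₂) rhoEx : Op₃ n n' 2) =
      (∑ i, ω i ⊗ₖ Λ₂ (proj (ket i))).submatrix e e := by
    rw [rhoEx_eq, map_smul, map_sum]
    simp_rw [proj_phi, tensorId_tensorMap_interleave]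
    ext p q
    simp [interleave, ω, e, mul_add, mul_assoc]
  -- The factors are swapped to put `B` first, as the entropy bound keeps the first marginal.
  have hAB : ∑ i, ω i = (∑ i, (((1 / 2 : ℝ) : ℂ) • proj (hadamardKet i)) ⊗ₖ
      Λ₁ (proj (hadamardKet i))).submatrix (Equiv.prodComm _ _) (Equiv.prodComm _ _) := by
    have h : ∑ i, ω i = tensorId Λ₁ (((1 / 2 : ℝ) : ℂ) • ∑ i, proj (bell i)) := by
      rw [map_smul, map_sum, Finset.smul_sum]
    rw [h, smul_sum_proj_bell, map_sum]
    simp_rw [map_smul, tensorId_kronecker]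
    ext p q
    simp [mul_comm, mul_assoc]
  have hη' : ∀ i, (((1 / 2 : ℝ) : ℂ) • proj (hadamardKet i)).PosSemidef := fun i =>
    (proj_posSemidef _).smul hhalf
  have hsum : ∑ i, ((1 / 2 : ℝ) : ℂ) • proj (hadamardKet i) =
      ((1 / 2 : ℝ) : ℂ) • (1 : Op 2) := by
    simp_rw [proj_hadamardKet]
    ext p q
    fin_cases p <;> fin_cases q <;> norm_num
  have hABH := (posSemidef_sum Finset.univ fun i _ => (hη' i).kronecker (hη i).1).isHermitian
  have hσH := (posSemidef_sum Finset.univ fun i _ => (hω i).kronecker (hτ i).1).isHermitian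
  rw [hσ, entropy_submatrix hσH]
  -- Drops the output of `A'`; the second application below drops that of `A`, leaving `B`.
  refine le_trans ?_ (entropy_sum_le_entropy_sum_kronecker hω hτ)
  rw [hAB, entropy_submatrix hABH]
  refine le_trans ?_ (entropy_sum_le_entropy_sum_kronecker hη' hη)
  rw [hsum, entropy_half_smul_one]

/-! ### The measure-and-correct protocol. -/

theorem correction_eq (i : Fin 2) :
    correction i = of fun p q => if p = q + i then 1 else 0 := by
  ext p q
  fin_cases i <;> fin_cases p <;> fin_cases q <;>
    simp [correction, show (1 : Fin 2) + 1 = 0 from rfl]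

/-- The Bell pair of `A` and `B` after the correction. -/
theorem tensorId_correction_bell (i : Fin 2) :
    tensorId (conjMap (correction i)) (proj (bell i)) = proj (bell 0) := by
  rw [proj_bell, proj_bell, correction_eq]
  ext ⟨p, p'⟩ ⟨q, q'⟩
  fin_cases i <;> fin_cases p <;> fin_cases p' <;> fin_cases q <;> fin_cases q' <;>
    simp [tensorId, conjMap, mul_apply, show (1 : Fin 2) + 1 = 0 from rfl]

theorem conjMap_proj_ket (i j : Fin 2) :
    conjMap (proj (ket i)) (proj (ket j)) = if i = j then proj (ket j) else 0 := by
  rw [conjMap_proj, proj_ket]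
  ext p q
  fin_cases i <;> fin_cases j <;> fin_cases p <;> fin_cases q <;>
    simp [proj, ket, vecMulVec_apply]

theorem tensorId_protocol_phi (j : Fin 2) :
    tensorId protocol (proj (phi j)) = proj (phi 0) := by
  rw [protocol, tensorId_sum, proj_phi, Finset.sum_eq_single j]
  · rw [tensorId_comp, tensorId_tensorMap_interleave, tensorId_tensorMap_interleave,
      conjMap_proj_ket, if_pos rfl]
    change interleave (tensorId (conjMap (correction j)) (proj (bell j))) (substMap _ _) = _
    rw [tensorId_correction_bell, proj_phi]
    congr 1
    change (proj (ket j)).trace • proj (ket 0) = _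
    rw [trace_proj, star_ket_dotProduct, if_pos rfl, one_smul]
  -- A wrong outcome has probability zero on `phi j`.
  · intro i _ hij
    rw [tensorId_comp, tensorId_tensorMap_interleave, tensorId_tensorMap_interleave,
      conjMap_proj_ket, if_neg hij, map_zero, interleave_zero]
  · simp

theorem tensorId_protocol_rhoEx : tensorId protocol rhoEx = proj phi0 := by
  rw [rhoEx_eq, map_smul, map_sum]
  simp_rw [tensorId_protocol_phi]
  rw [Fin.sum_univ_two, smul_add, ← add_smul, phi_zero]
  norm_num

theorem isCPTP_correction (i : Fin 2) : IsCPTP (conjMap (correction i)) := by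
  refine isCPTP_conjMap ?_
  fin_cases i
  · simp [correction]
  · ext p q
    fin_cases p <;> fin_cases q <;> simp [correction, mul_apply]

theorem isLOCC_protocol : IsLOCC protocol := by
  refine IsLOCC.second (fun i : Fin 2 => conjMap (proj (ket i))) ⟨fun i => isCP_conjMap _, ?_⟩ _
    fun i => isLOCC_tensorMap (isCPTP_correction i)
      (isCPTP_substMap (by rw [star_ket_dotProduct, if_pos rfl]))
  intro X
  simp [conjMap, proj_ket, trace, mul_apply]

end Example

end DenseCoding

theorem mainTheorem2 :
    -- the initial state
    (IsDensity rhoEx ∧ entropy rhoEx = 1 ∧ entropy (traceFst rhoEx) = 1 ∧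
      coherentInfo rhoEx = 0) ∧
    -- separability in the cut A' : AB, and of the reduction to AB
    (IsSepState (cutSecond rhoEx) ∧ IsSepState (traceFst (cutSecond rhoEx))) ∧
    -- no advantage by local operations
    advantage IsLO rhoEx = 0 ∧
    -- the protocol is LOCC and yields a Bell pair of A and B, with coherent information 1
    (IsLOCC protocol ∧ tensorId protocol rhoEx = proj phi0 ∧
      entropy (tensorId protocol rhoEx) = 0 ∧ coherentInfo (tensorId protocol rhoEx) = 1) ∧
    -- the advantage by local operations and classical communication
    1 ≤ advantage IsLOCC rhoEx := by
  have hB : entropy (traceFst rhoEx) = 1 := by rw [traceFst_rhoEx, entropy_half_smul_one]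
  have hphi : entropy (proj phi0) = 0 := by
    rw [← phi_zero]
    exact entropy_proj (by rw [star_phi_dotProduct, if_pos rfl])
  refine ⟨⟨isDensity_rhoEx, entropy_rhoEx, hB, ?_⟩,
    ⟨isSepState_cutSecond_rhoEx, isSepState_traceFst_cutSecond_rhoEx⟩, ?_,
    ⟨isLOCC_protocol, tensorId_protocol_rhoEx, ?_, ?_⟩, ?_⟩
  · rw [coherentInfo, hB, entropy_rhoEx, sub_self]
  · have hid : IsLO (LinearMap.id : Op₂ 2 2 →ₗ[ℂ] Op₂ 2 2) :=
      ⟨LinearMap.id, LinearMap.id, isCPTP_id, isCPTP_id, rfl⟩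
    have hinf : (⨅ (n : ℕ) (n' : ℕ) (Λ : Op₂ 2 2 →ₗ[ℂ] Op₂ n n') (_ : IsLO Λ),
        (entropy (tensorId Λ rhoEx : Op₃ n n' 2) : EReal)) = 1 := by
      refine le_antisymm ?_ ?_
      · refine iInf_le_of_le 2 (iInf_le_of_le 2 (iInf_le_of_le LinearMap.id
          (iInf_le_of_le hid (le_of_eq ?_))))
        have h : (tensorId LinearMap.id rhoEx : Op₃ 2 2 2) = rhoEx := rfl
        rw [h, entropy_rhoEx, EReal.coe_one]
      · refine le_iInf fun n => le_iInf fun n' => le_iInf fun Λ => le_iInf fun hΛ => ?_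
        exact_mod_cast one_le_entropy_of_isLO hΛ
    rw [advantage, hinf, hB, ← EReal.coe_one, ← EReal.coe_sub, sub_self, EReal.coe_zero]
  · rw [tensorId_protocol_rhoEx, hphi]
  · rw [tensorId_protocol_rhoEx, coherentInfo, hphi, ← phi_zero, traceFst_proj_phi,
      entropy_half_smul_one, sub_zero]
  · have hinf : (⨅ (n : ℕ) (n' : ℕ) (Λ : Op₂ 2 2 →ₗ[ℂ] Op₂ n n') (_ : IsLOCC Λ),
        (entropy (tensorId Λ rhoEx : Op₃ n n' 2) : EReal)) ≤ 0 := by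
      refine iInf_le_of_le 2 (iInf_le_of_le 2 (iInf_le_of_le protocol
        (iInf_le_of_le isLOCC_protocol (le_of_eq ?_))))
      rw [tensorId_protocol_rhoEx, hphi, EReal.coe_zero]
    rw [advantage, hB, EReal.coe_one]
    -- The protocol bounds the infimum by 0, so the advantage is at least `1 - 0`.
    simpa using EReal.sub_le_sub (le_refl (1 : EReal)) hinf
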